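/- **Proposition ($\ell_1$-RIP for distributed sparse matrices).** For a real matrix $M$ write $\|M\|_1=\sum_{i,j}|M_{ij}|$. A set $\Omega\subseteq[p]\times[p]$ is *$d$-distributed* if $(i,i)\in\Omega$ for all $i\in[p]$ and every row $\{j:(k,j)\in\Omega\}$ and every column $\{i:(i,k)\in\Omega\}$ has at most $d$ elements; a matrix $X\in\mathbb{R}^{p\times p}$ is *$d$-distributed sparse* if its support is contained in some $d$-distributed set. A *$\delta$-left regular bipartite multigraph* with left set $[p]$ and right set $[m]$ has exactly $\delta$ edges (counted with multiplicity) at each left vertex; its adjacency matrix is the $m\times p$ matrix $A$ in which $A_{ji}$ is the number of edges between $i\in[p]$ and $j\in[m]$. The *uniformly random* such graph is obtained by choosing, for each $i\in[p]$, the right endpoints of its $\delta$ edges independently and uniformly from $[m]$ (with replacement), independently over $i$. (a) For all $p,m,\delta$, the adjacency matrix $A$ of every $\delta$-left regular bipartite multigraph and every $X\in\mathbb{R}^{p\times p}$ satisfy $\|AXA^T\|_1\le\delta^2\|X\|_1$. (b) For every $\epsilon\in(0,\tfrac14)$ there are constants $c,C_1,C_2>0$, depending only on $\epsilon$, such that the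 following holds for all integers $p\ge1$ and $d,\delta,m\ge0$ with $$\delta\ge C_1\log p,\qquad m\ge C_2\,\delta\sqrt{dp}$$ (in particular, $\delta=\Theta(\log p)$ and $m=\Theta(\sqrt{dp}\,\log p)$ with suitable constants are allowed). Let $X\in\mathbb{R}^{p\times p}$ be a fixed $d$-distributed sparse matrix and let $A$ be the adjacency matrix of a uniformly random $\delta$-left regular bipartite multigraph with left set $[p]$ and right set $[m]$. Then, with probability exceeding $1-p^{-c}$, $$(1-2\epsilon)\,\delta^2\|X\|_1\le\|AXA^T\|_1\le\delta^2\|X\|_1 .$$ -/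

import Mathlib

open MeasureTheory ProbabilityTheory
open scoped Matrix

namespace L1RIP

/-- The `ℓ₁` norm of a matrix, viewed as a vector: the sum of the absolute values of its entries. -/
noncomputable def l1norm {a b : ℕ} (X : Matrix (Fin a) (Fin b) ℝ) : ℝ :=
  ∑ i, ∑ j, |X i j|

/-- A set `S ⊆ [p] × [p]` is `d`-distributed if it contains the diagonal and has at most `d`
elements in each row and in each column. -/
def IsDistributed {p : ℕ} (d : ℕ) (S : Finset (Fin p × Fin p)) : Prop :=
  (∀ i, (i, i) ∈ S) ∧
    ∀ k, (S.filter fun e => e.1 = k).card ≤ d ∧ (S.filter fun e => e.2 = k).card ≤ d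

/-- A matrix is `d`-distributed sparse if its support lies in some `d`-distributed set. -/
def IsDistributedSparse {p : ℕ} (d : ℕ) (X : Matrix (Fin p) (Fin p) ℝ) : Prop :=
  ∃ S : Finset (Fin p × Fin p), IsDistributed d S ∧ ∀ i j, X i j ≠ 0 → (i, j) ∈ S

/-- A `δ`-left regular bipartite (multi)graph with left set `[p]` and right set `[m]`:
`G i k` is the right endpoint of the `k`-th of the `δ` edges leaving the left vertex `i`. -/
abbrev LeftRegularGraph (p m δ : ℕ) : Type := Fin p → Fin δ → Fin m

/-- The `m × p` adjacency matrix: the entry `(j, i)` is the number of edges between the left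
vertex `i` and the right vertex `j`, counted with multiplicity. -/
def adjMatrix {p m δ : ℕ} (G : LeftRegularGraph p m δ) : Matrix (Fin m) (Fin p) ℝ :=
  Matrix.of fun j i => ((Finset.univ.filter fun k : Fin δ => G i k = j).card : ℝ)

/-- The law of the uniformly random `δ`-left regular bipartite graph: all the `p * δ` right
endpoints are drawn independently and uniformly from `[m]`, with replacement. -/
noncomputable def randomGraph (p m δ : ℕ) : Measure (LeftRegularGraph p m δ) :=
  Measure.pi fun _ : Fin p => Measure.pi fun _ : Fin δ => uniformOn (Set.univ : Set (Fin m))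

end L1RIP

namespace L1RIP

/-! ### The sketch of a matrix, entry by entry -/

/-! Each pair `(i, j)` has `δ ^ 2` edges in the tensor square of the graph, and the entry `(u, v)`
of the sketch adds `X i j` over the edges that end in the cell `(u, v)`. The triangle inequality
gives the upper bound. Norm is lost only by cancellation, which needs a cell reached from two pairs
of the support set `Ω`. So if at most `ε * δ ^ 2` edges of each pair collide, the fraction `1 - ε`
of the norm survives (`le_l1norm_sketch`).

It remains to bound the collisions at a fixed pair `(i, j)`. Its `δ ^ 2` edges come from only `2 *
δ` random endpoints (`δ` if `i = j`), so they are far from independent. Collisions with pairs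
sharing a vertex with `(i, j)` reduce to one endpoint hitting a sparse set. The other pairs of `Ω`
occupy a sparse set of far cells that does not depend on the edges at `i` and `j`. Few rows contain
many far cells, so few edges at `i` enter heavy rows. The remaining edges at `i` see few far cells
in total, so few columns are bad for many of them, and few edges at `j` enter those columns. If `i =
j`, the edges are revealed one by one and each is compared with the earlier ones only.

Each "few" is an exponential moment bound for hits of bad sets determined by the past
(`card_many_hits_le`), which fails with probability at most `exp (-δ)`. A union bound over `p ^ 2`
pairs finishes the proof, since `δ` is a large multiple of `log p`. -/

lemma l1norm_eq_sum_prod {a b : ℕ} (X : Matrix (Fin a) (Fin b) ℝ) :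
    l1norm X = ∑ e : Fin a × Fin b, |X e.1 e.2| := by
  rw [l1norm, Fintype.sum_prod_type]

lemma adjMatrix_nonneg {p m δ : ℕ} (G : LeftRegularGraph p m δ) (u : Fin m) (i : Fin p) :
    0 ≤ adjMatrix G u i := by
  simp [adjMatrix]

lemma sum_adjMatrix_mul {p m δ : ℕ} (G : LeftRegularGraph p m δ) (i : Fin p) (f : Fin m → ℝ) :
    ∑ u, adjMatrix G u i * f u = ∑ k, f (G i k) := by
  have h : ∀ u, adjMatrix G u i * f u = ∑ k, if G i k = u then f u else 0 := by
    intro u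
    simp [adjMatrix, Finset.sum_ite]
  simp_rw [h]
  rw [Finset.sum_comm]
  simp

lemma sum_adjMatrix_mul_mul {p m δ : ℕ} (G : LeftRegularGraph p m δ) (e : Fin p × Fin p)
    (f : Fin m → Fin m → ℝ) :
    ∑ w : Fin m × Fin m, adjMatrix G w.1 e.1 * adjMatrix G w.2 e.2 * f w.1 w.2 =
      ∑ κ : Fin δ × Fin δ, f (G e.1 κ.1) (G e.2 κ.2) := by
  simp_rw [Fintype.sum_prod_type, mul_assoc, ← Finset.mul_sum, sum_adjMatrix_mul]

lemma sketch_apply {p m δ : ℕ} (G : LeftRegularGraph p m δ) (X : Matrix (Fin p) (Fin p) ℝ)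
    (u v : Fin m) :
    (adjMatrix G * X * (adjMatrix G)ᵀ) u v =
      ∑ e : Fin p × Fin p, X e.1 e.2 * (adjMatrix G u e.1 * adjMatrix G v e.2) := by
  simp_rw [Matrix.mul_apply, Matrix.transpose_apply, Finset.sum_mul]
  rw [Finset.sum_comm, Fintype.sum_prod_type]
  refine Finset.sum_congr rfl fun i _ => Finset.sum_congr rfl fun j _ => ?_
  ring

theorem l1norm_sketch_le {p m δ : ℕ} (G : LeftRegularGraph p m δ)
    (X : Matrix (Fin p) (Fin p) ℝ) :
    l1norm (adjMatrix G * X * (adjMatrix G)ᵀ) ≤ (δ : ℝ) ^ 2 * l1norm X := by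
  have hsum : ∀ e : Fin p × Fin p,
      ∑ w : Fin m × Fin m, adjMatrix G w.1 e.1 * adjMatrix G w.2 e.2 = (δ : ℝ) ^ 2 := by
    intro e
    have := sum_adjMatrix_mul_mul G e fun _ _ => 1
    simpa [sq] using this
  calc l1norm (adjMatrix G * X * (adjMatrix G)ᵀ)
      ≤ ∑ w : Fin m × Fin m, ∑ e : Fin p × Fin p,
          |X e.1 e.2| * (adjMatrix G w.1 e.1 * adjMatrix G w.2 e.2) := by
        rw [l1norm_eq_sum_prod]
        refine Finset.sum_le_sum fun w _ => ?_
        rw [sketch_apply]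
        refine (Finset.abs_sum_le_sum_abs _ _).trans (Finset.sum_le_sum fun e _ => ?_)
        rw [abs_mul, abs_of_nonneg (mul_nonneg (adjMatrix_nonneg _ _ _) (adjMatrix_nonneg _ _ _))]
    _ = (δ : ℝ) ^ 2 * l1norm X := by
        rw [Finset.sum_comm, l1norm_eq_sum_prod, Finset.mul_sum]
        refine Finset.sum_congr rfl fun e _ => ?_
        rw [← Finset.mul_sum, hsum, mul_comm]

/-! ### Collisions -/

/-- The cell `(u, v)` receives an edge of the tensor square of `G` from a pair of `Ω` other
than `e`. -/
def Collides {p m δ : ℕ} (G : LeftRegularGraph p m δ) (Ω : Finset (Fin p × Fin p))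
    (e : Fin p × Fin p) (u v : Fin m) : Prop :=
  ∃ e' ∈ Ω, e' ≠ e ∧ (∃ k, G e'.1 k = u) ∧ ∃ l, G e'.2 l = v

open Classical in
/-- The edges of the tensor square of `G` leaving `e` that collide with an edge leaving another
pair of `Ω`. -/
noncomputable def collisions {p m δ : ℕ} (G : LeftRegularGraph p m δ)
    (Ω : Finset (Fin p × Fin p)) (e : Fin p × Fin p) : Finset (Fin δ × Fin δ) :=
  Finset.univ.filter fun κ => Collides G Ω e (G e.1 κ.1) (G e.2 κ.2)

lemma adjMatrix_eq_zero {p m δ : ℕ} {G : LeftRegularGraph p m δ} {u : Fin m} {i : Fin p}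
    (h : ¬ ∃ k, G i k = u) : adjMatrix G u i = 0 := by
  simpa [adjMatrix, Finset.filter_eq_empty_iff] using h

open Classical in
-- If some supported pair reaches the cell without collision, it is the only one to do so. Both sums
-- then reduce to that single term, and nothing cancels.
lemma sum_isolated_le_abs_sketch {p m δ : ℕ} (G : LeftRegularGraph p m δ)
    {Ω : Finset (Fin p × Fin p)} {X : Matrix (Fin p) (Fin p) ℝ}
    (hX : ∀ i j, X i j ≠ 0 → (i, j) ∈ Ω) (u v : Fin m) :
    ∑ e : Fin p × Fin p, |X e.1 e.2| *
        (adjMatrix G u e.1 * adjMatrix G v e.2 * if Collides G Ω e u v then 0 else 1) ≤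
      |(adjMatrix G * X * (adjMatrix G)ᵀ) u v| := by
  by_cases h : ∃ e : Fin p × Fin p, |X e.1 e.2| *
        (adjMatrix G u e.1 * adjMatrix G v e.2 * if Collides G Ω e u v then 0 else 1) ≠ 0
  · obtain ⟨e, he⟩ := h
    have hcol : ¬ Collides G Ω e u v := by
      intro hc
      simp [hc] at he
    have hother : ∀ e', e' ≠ e → X e'.1 e'.2 * (adjMatrix G u e'.1 * adjMatrix G v e'.2) = 0 := by
      intro e' hne
      by_contra h0
      have hXe : X e'.1 e'.2 ≠ 0 := left_ne_zero_of_mul h0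
      have hA := right_ne_zero_of_mul h0
      refine hcol ⟨e', hX _ _ hXe, hne, ?_, ?_⟩
      · by_contra hk
        exact left_ne_zero_of_mul hA (adjMatrix_eq_zero hk)
      · by_contra hk
        exact right_ne_zero_of_mul hA (adjMatrix_eq_zero hk)
    rw [sketch_apply, Fintype.sum_eq_single e hother, Fintype.sum_eq_single e]
    · rw [abs_mul, abs_of_nonneg (mul_nonneg (adjMatrix_nonneg G u _) (adjMatrix_nonneg G v _))]
      simp [hcol]
    · intro e' hne
      rcases mul_eq_zero.1 (hother e' hne) with h0 | h0 <;> simp [h0]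
  · push Not at h
    rw [Finset.sum_eq_zero fun e _ => h e]
    exact abs_nonneg _

/-- If few edges leaving each pair of `Ω` collide, then the sketch nearly preserves the norm of
every matrix supported in `Ω`. -/
theorem le_l1norm_sketch {p m δ : ℕ} (G : LeftRegularGraph p m δ)
    {Ω : Finset (Fin p × Fin p)} {X : Matrix (Fin p) (Fin p) ℝ}
    (hX : ∀ i j, X i j ≠ 0 → (i, j) ∈ Ω) {ε : ℝ}
    (hcol : ∀ e ∈ Ω, ((collisions G Ω e).card : ℝ) ≤ ε * (δ : ℝ) ^ 2) :
    (1 - ε) * (δ : ℝ) ^ 2 * l1norm X ≤ l1norm (adjMatrix G * X * (adjMatrix G)ᵀ) := by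
  classical
  calc (1 - ε) * (δ : ℝ) ^ 2 * l1norm X
      ≤ ∑ e : Fin p × Fin p, |X e.1 e.2| * ∑ w : Fin m × Fin m,
          (adjMatrix G w.1 e.1 * adjMatrix G w.2 e.2 *
            if Collides G Ω e w.1 w.2 then 0 else 1) := by
        rw [l1norm_eq_sum_prod, Finset.mul_sum]
        refine Finset.sum_le_sum fun e _ => ?_
        by_cases he : X e.1 e.2 = 0
        · simp [he]
        rw [sum_adjMatrix_mul_mul G e fun u v => if Collides G Ω e u v then 0 else 1, mul_comm]
        refine mul_le_mul_of_nonneg_left ?_ (abs_nonneg _)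
        have h1 : ∑ κ : Fin δ × Fin δ,
            (if Collides G Ω e (G e.1 κ.1) (G e.2 κ.2) then (0 : ℝ) else 1) =
              (δ : ℝ) ^ 2 - (collisions G Ω e).card := by
          have h2 : ∀ κ : Fin δ × Fin δ,
              (if Collides G Ω e (G e.1 κ.1) (G e.2 κ.2) then (0 : ℝ) else 1) =
                1 - if Collides G Ω e (G e.1 κ.1) (G e.2 κ.2) then 1 else 0 := by
            intro κ
            split_ifs <;> simp
          simp_rw [h2, Finset.sum_sub_distrib, Finset.sum_boole]
          simp [collisions, sq]
        rw [h1]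
        linarith [hcol e (hX _ _ he)]
    _ = ∑ w : Fin m × Fin m, ∑ e : Fin p × Fin p, |X e.1 e.2| *
          (adjMatrix G w.1 e.1 * adjMatrix G w.2 e.2 *
            if Collides G Ω e w.1 w.2 then 0 else 1) := by
        simp_rw [Finset.mul_sum]
        rw [Finset.sum_comm]
    _ ≤ l1norm (adjMatrix G * X * (adjMatrix G)ᵀ) := by
        rw [l1norm_eq_sum_prod]
        exact Finset.sum_le_sum fun w _ => sum_isolated_le_abs_sketch G hX w.1 w.2

/-! ### A tail bound for adapted bad sets -/

open Classical in
-- Given the past, one step contributes a factor of at most `1 + t * η ≤ 2` on average. Here sums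
-- replace expectations, hence the extra `m` per coordinate.
lemma sum_prod_adapted_le {m : ℕ} {η t : ℝ} (ht : 1 ≤ t) (htη : t * η ≤ 1) (n : ℕ)
    (W : (Fin n → Fin m) → Fin n → Finset (Fin m))
    (hW : ∀ x y l, (∀ k < l, x k = y k) → W x l = W y l)
    (hcard : ∀ x l, ((W x l).card : ℝ) ≤ η * m) :
    ∑ x : Fin n → Fin m, ∏ l, (if x l ∈ W x l then t else 1) ≤ (2 * (m : ℝ)) ^ n := by
  induction n with
  | zero => simp
  | succ n ih =>
    rcases Nat.eq_zero_or_pos m with rfl | hm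
    · simp
    have : NeZero m := ⟨hm.ne'⟩
    -- The first bad set depends on nothing, so it may be evaluated at an arbitrary vector.
    set W₀ := W 0 0 with hW₀
    have hfirst : ∀ x, W x 0 = W₀ := fun x => hW _ _ _ fun k hk => absurd hk (Fin.not_lt_zero k)
    rw [← (Fin.consEquiv fun _ : Fin (n + 1) => Fin m).sum_comp, Fintype.sum_prod_type]
    calc ∑ a : Fin m, ∑ y : Fin n → Fin m,
          ∏ l, (if Fin.consEquiv (fun _ => Fin m) (a, y) l ∈
            W (Fin.consEquiv (fun _ => Fin m) (a, y)) l then t else 1)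
        = ∑ a : Fin m, (if a ∈ W₀ then t else 1) * ∑ y : Fin n → Fin m,
            ∏ l : Fin n, (if y l ∈ W (Fin.cons a y : Fin (n + 1) → Fin m) l.succ then t else 1) := by
          refine Finset.sum_congr rfl fun a _ => ?_
          rw [Finset.mul_sum]
          refine Finset.sum_congr rfl fun y _ => ?_
          rw [Fin.prod_univ_succ]
          simp [Fin.consEquiv, hfirst]
      _ ≤ ∑ a : Fin m, (if a ∈ W₀ then t else 1) * (2 * (m : ℝ)) ^ n := by
          refine Finset.sum_le_sum fun a _ => mul_le_mul_of_nonneg_left ?_ ?_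
          · refine ih (fun y l => W (Fin.cons a y : Fin (n + 1) → Fin m) l.succ) ?_
              fun y l => hcard _ _
            intro x y l h
            refine hW _ _ _ fun k hk => ?_
            induction k using Fin.cases with
            | zero => simp
            | succ k => simpa using h k (by simpa using hk)
          · split_ifs <;> linarith
      _ ≤ (2 * (m : ℝ)) ^ (n + 1) := by
          rw [← Finset.sum_mul, pow_succ']
          refine mul_le_mul_of_nonneg_right ?_ (by positivity)
          have h1 : ∀ a : Fin m, (if a ∈ W₀ then t else 1) ≤ 1 + t * if a ∈ W₀ then 1 else 0 := by
            intro a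
            split_ifs <;> linarith
          refine (Finset.sum_le_sum fun a _ => h1 a).trans ?_
          rw [Finset.sum_add_distrib, ← Finset.mul_sum, Finset.sum_boole]
          simp only [Finset.sum_const, Finset.card_univ, Fintype.card_fin, nsmul_eq_mul, mul_one,
            Finset.filter_mem_eq_inter, Finset.univ_inter]
          have h2 := mul_le_mul_of_nonneg_left (hcard 0 0) (by linarith : (0 : ℝ) ≤ t)
          have h3 := mul_le_mul_of_nonneg_right htη (Nat.cast_nonneg (α := ℝ) m)
          rw [← hW₀] at h2
          linarith

/-- `G` and `G'` agree on all edges except possibly those numbered `l` or later at the left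
vertex `i`. -/
def AgreeBefore {p m δ : ℕ} (i : Fin p) (l : Fin δ) (G G' : LeftRegularGraph p m δ) : Prop :=
  (∀ i', i' ≠ i → G i' = G' i') ∧ ∀ k < l, G i k = G' i k

open Classical in
-- Freeze the edges at all vertices other than `i`; the bad sets are then adapted to the sequence of
-- endpoints at `i` alone.
lemma sum_prod_adapted_graph_le {p m δ : ℕ} {η t : ℝ} (ht : 1 ≤ t) (htη : t * η ≤ 1) (i : Fin p)
    (W : LeftRegularGraph p m δ → Fin δ → Finset (Fin m))
    (hW : ∀ G G' l, AgreeBefore i l G G' → W G l = W G' l)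
    (hcard : ∀ G l, ((W G l).card : ℝ) ≤ η * m) :
    ∑ G : LeftRegularGraph p m δ, ∏ l, (if G i l ∈ W G l then t else 1) ≤
      2 ^ δ * Fintype.card (LeftRegularGraph p m δ) := by
  let φ := Equiv.funSplitAt i (Fin δ → Fin m)
  have hi : ∀ w, φ.symm w i = w.1 := by intro w; simp [φ]
  have hne : ∀ w i' (h : i' ≠ i), φ.symm w i' = w.2 ⟨i', h⟩ := by intro w i' h; simp [φ, h]
  rw [← φ.symm.sum_comp, Fintype.sum_prod_type_right, Fintype.card_congr φ, Fintype.card_prod]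
  calc ∑ y, ∑ x, ∏ l, (if φ.symm (x, y) i l ∈ W (φ.symm (x, y)) l then t else 1)
      ≤ ∑ y : {j // j ≠ i} → Fin δ → Fin m, (2 * (m : ℝ)) ^ δ := by
        refine Finset.sum_le_sum fun y _ => ?_
        simp_rw [hi]
        refine sum_prod_adapted_le ht htη δ (fun x l => W (φ.symm (x, y)) l) ?_ fun _ _ => hcard _ _
        intro x x' l h
        refine hW _ _ _ ⟨fun i' hi' => ?_, fun k hk => ?_⟩
        · rw [hne _ _ hi', hne _ _ hi']
        · rw [hi, hi]; exact h k hk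
    _ = _ := by
        simp
        ring

open Classical in
/-- If the edges at `i` are revealed one after another, then it is unlikely that more than the
fraction `α` of them lands in bad sets of small density that depend on what was revealed before. -/
theorem card_many_hits_le {p m δ : ℕ} {α η : ℝ} (hα : 0 < α)
    (hη : η = (2 * Real.exp 1) ^ (-α⁻¹)) (i : Fin p)
    (W : LeftRegularGraph p m δ → Fin δ → Finset (Fin m))
    (hW : ∀ G G' l, AgreeBefore i l G G' → W G l = W G' l)
    (hcard : ∀ G l, ((W G l).card : ℝ) ≤ η * m) :
    ((Finset.univ.filter fun G : LeftRegularGraph p m δ =>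
        α * δ < ((Finset.univ.filter fun l => G i l ∈ W G l).card : ℝ)).card : ℝ) ≤
      Real.exp (-δ) * Fintype.card (LeftRegularGraph p m δ) := by
  set B := 2 * Real.exp 1 with hB
  have hB1 : 1 ≤ B := by
    have := Real.one_le_exp (zero_le_one' ℝ)
    linarith
  have hB0 : 0 < B := by linarith
  -- With this weight `t * η = 1`, and `α * δ` hits weigh `(2 * e) ^ δ`: the `2 ^ δ` pays for the
  -- moment bound and `e ^ δ` is the gain.
  set t := B ^ α⁻¹ with ht
  have ht1 : 1 ≤ t := Real.one_le_rpow hB1 (by positivity)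
  have htη : t * η ≤ 1 := by
    rw [hη, ht, ← Real.rpow_add hB0]
    simp
  have htα : t ^ (α * δ) = B ^ δ := by
    rw [ht, ← Real.rpow_mul hB0.le, inv_mul_cancel_left₀ hα.ne', Real.rpow_natCast]
  have hsum := sum_prod_adapted_graph_le ht1 htη i W hW hcard
  set F := Finset.univ.filter fun G : LeftRegularGraph p m δ =>
        α * δ < ((Finset.univ.filter fun l => G i l ∈ W G l).card : ℝ) with hF
  have hnonneg : ∀ G : LeftRegularGraph p m δ,
      0 ≤ ∏ l, (if G i l ∈ W G l then t else 1) := by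
    intro G
    refine Finset.prod_nonneg fun l _ => ?_
    split_ifs <;> linarith
  have hmarkov : F.card * B ^ δ ≤ 2 ^ δ * Fintype.card (LeftRegularGraph p m δ) := by
    refine le_trans ?_ hsum
    rw [← nsmul_eq_mul]
    refine (Finset.card_nsmul_le_sum F _ _ fun G hG => ?_).trans
      (Finset.sum_le_sum_of_subset_of_nonneg (Finset.subset_univ F) fun G _ _ => hnonneg G)
    rw [hF, Finset.mem_filter] at hG
    have : ∏ l, (if G i l ∈ W G l then t else 1) =
        t ^ (Finset.univ.filter fun l => G i l ∈ W G l).card := by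
      simp [Finset.prod_ite]
    rw [this, ← htα, ← Real.rpow_natCast]
    exact Real.rpow_le_rpow_of_exponent_le ht1 hG.2.le
  have hexp : B ^ δ = 2 ^ δ * Real.exp δ := by
    rw [hB, mul_pow, ← Real.exp_nat_mul, mul_one]
  rw [hexp] at hmarkov
  have h2 : (F.card : ℝ) * Real.exp δ ≤ Fintype.card (LeftRegularGraph p m δ) := by
    have : (0 : ℝ) < 2 ^ δ := by positivity
    refine le_of_mul_le_mul_left ?_ this
    linarith
  rw [Real.exp_neg, inv_mul_eq_div, le_div_iff₀ (Real.exp_pos _)]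
  exact h2

/-! ### Collisions at a fixed pair -/

open Classical in
/-- The cells `v` hit by a left vertex other than `j` that is `i` or shares row `i` of `Ω`. -/
noncomputable def rowReach {p m δ : ℕ} (Ω : Finset (Fin p × Fin p)) (i j : Fin p)
    (G : LeftRegularGraph p m δ) : Finset (Fin m) :=
  Finset.univ.filter fun v => ∃ j', j' ≠ j ∧ (j' = i ∨ (i, j') ∈ Ω) ∧ ∃ l, G j' l = v

open Classical in
/-- The cells hit by the pairs of `Ω` that involve neither `i` nor `j`. -/
noncomputable def farCells {p m δ : ℕ} (Ω : Finset (Fin p × Fin p)) (i j : Fin p)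
    (G : LeftRegularGraph p m δ) : Finset (Fin m × Fin m) :=
  Finset.univ.filter fun w => ∃ e ∈ Ω, (e.1 ≠ i ∧ e.1 ≠ j) ∧ (e.2 ≠ i ∧ e.2 ≠ j) ∧
    (∃ k, G e.1 k = w.1) ∧ ∃ l, G e.2 l = w.2

open Classical in
/-- The rows `u` that contain more than `r` of the cells of `U`. -/
noncomputable def heavyRows {m : ℕ} (U : Finset (Fin m × Fin m)) (r : ℝ) : Finset (Fin m) :=
  Finset.univ.filter fun u => r < ((Finset.univ.filter fun v => (u, v) ∈ U).card : ℝ)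

open Classical in
/-- The cells `v` for which more than `r` of the edges at `i` (of those before the `l`-th, if
`i = j`) lead to a row `u` that is not heavy, with `(u, v)` a far cell. -/
noncomputable def heavyColumns {p m δ : ℕ} (Ω : Finset (Fin p × Fin p)) (i j : Fin p) (h r : ℝ)
    (G : LeftRegularGraph p m δ) (l : Fin δ) : Finset (Fin m) :=
  Finset.univ.filter fun v => r < ((Finset.univ.filter fun k : Fin δ => (i ≠ j ∨ k < l) ∧
    G i k ∉ heavyRows (farCells Ω i j G) h ∧ (G i k, v) ∈ farCells Ω i j G).card : ℝ)

open Classical in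
lemma mul_card_lt_le_sum {ι : Type*} [Fintype ι] (f : ι → ℕ) (r : ℝ) :
    r * ((Finset.univ.filter fun a => r < (f a : ℝ)).card : ℝ) ≤ ∑ a, (f a : ℝ) := by
  rw [mul_comm, ← nsmul_eq_mul]
  refine (Finset.card_nsmul_le_sum _ (fun a => (f a : ℝ)) r fun a ha => ?_).trans
    (Finset.sum_le_sum_of_subset_of_nonneg (Finset.subset_univ _) fun a _ _ => Nat.cast_nonneg _)
  exact (Finset.mem_filter.1 ha).2.le

lemma card_rowReach_le {p m δ : ℕ} (Ω : Finset (Fin p × Fin p)) (i j : Fin p)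
    (G : LeftRegularGraph p m δ) :
    (rowReach Ω i j G).card ≤ ((Ω.filter fun e => e.1 = i).card + 1) * δ := by
  classical
  have hsub : rowReach Ω i j G ⊆
      (insert i ((Ω.filter fun e => e.1 = i).image Prod.snd) ×ˢ
        (Finset.univ : Finset (Fin δ))).image fun a => G a.1 a.2 := by
    intro v hv
    obtain ⟨j', -, hj', l, hl⟩ := (Finset.mem_filter.1 hv).2
    refine Finset.mem_image.2 ⟨(j', l), ?_, hl⟩
    simpa using hj'
  refine (Finset.card_le_card hsub).trans (Finset.card_image_le.trans ?_)
  rw [Finset.card_product, Finset.card_univ, Fintype.card_fin]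
  exact Nat.mul_le_mul_right _ ((Finset.card_insert_le _ _).trans
    (Nat.add_le_add_right Finset.card_image_le _))

lemma card_farCells_le {p m δ : ℕ} (Ω : Finset (Fin p × Fin p)) (i j : Fin p)
    (G : LeftRegularGraph p m δ) :
    (farCells Ω i j G).card ≤ Ω.card * (δ * δ) := by
  classical
  have hsub : farCells Ω i j G ⊆
      (Ω ×ˢ (Finset.univ : Finset (Fin δ × Fin δ))).image
        fun a => (G a.1.1 a.2.1, G a.1.2 a.2.2) := by
    intro w hw
    obtain ⟨e, he, -, -, ⟨k, hk⟩, l, hl⟩ := (Finset.mem_filter.1 hw).2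
    exact Finset.mem_image.2 ⟨(e, k, l), by simpa using he, Prod.ext hk hl⟩
  refine (Finset.card_le_card hsub).trans (Finset.card_image_le.trans ?_)
  simp [Finset.card_product]

lemma mul_card_heavyRows_le {m : ℕ} (U : Finset (Fin m × Fin m)) (r : ℝ) :
    r * ((heavyRows U r).card : ℝ) ≤ U.card := by
  classical
  refine (mul_card_lt_le_sum (fun u => (Finset.univ.filter fun v => (u, v) ∈ U).card) r).trans ?_
  rw [← Nat.cast_sum, Nat.cast_le]
  simp_rw [Finset.card_filter]
  rw [← Fintype.sum_prod_type (f := fun w : Fin m × Fin m => if w ∈ U then 1 else 0)]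
  simp

/-- Each edge at `i` into a row that is not heavy sees at most `h` far cells, so all `δ` of them see
at most `δ * h`; Markov's inequality over the columns does the rest. -/
lemma mul_card_heavyColumns_le {p m δ : ℕ} (Ω : Finset (Fin p × Fin p)) (i j : Fin p) {h : ℝ}
    (hh : 0 ≤ h) (r : ℝ) (G : LeftRegularGraph p m δ) (l : Fin δ) :
    r * ((heavyColumns Ω i j h r G l).card : ℝ) ≤ δ * h := by
  classical
  refine (mul_card_lt_le_sum _ r).trans ?_
  simp_rw [Finset.card_filter, Nat.cast_sum]
  rw [Finset.sum_comm]
  calc _ ≤ ∑ _k : Fin δ, h := by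
        refine Finset.sum_le_sum fun k _ => ?_
        by_cases hk : G i k ∈ heavyRows (farCells Ω i j G) h
        · simpa [hk] using hh
        · have hk' := hk
          simp only [heavyRows, Finset.mem_filter, Finset.mem_univ, true_and, not_lt] at hk'
          refine le_trans ?_ hk'
          rw [Finset.card_filter, Nat.cast_sum]
          refine Finset.sum_le_sum fun v _ => ?_
          by_cases hv : (G i k, v) ∈ farCells Ω i j G
          · simp only [hv, if_true]
            split_ifs <;> simp
          · simp [hv]
    _ = δ * h := by simp

lemma rowReach_congr {p m δ : ℕ} {Ω : Finset (Fin p × Fin p)} {i j : Fin p}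
    {G G' : LeftRegularGraph p m δ} (h : ∀ i', i' ≠ j → G i' = G' i') :
    rowReach Ω i j G = rowReach Ω i j G' := by
  refine Finset.filter_congr fun v _ => exists_congr fun j' => and_congr_right fun hj' => ?_
  rw [h j' hj']

lemma farCells_congr {p m δ : ℕ} {Ω : Finset (Fin p × Fin p)} {i j : Fin p}
    {G G' : LeftRegularGraph p m δ} (h : ∀ i', i' ≠ i → i' ≠ j → G i' = G' i') :
    farCells Ω i j G = farCells Ω i j G' := by
  refine Finset.filter_congr fun v _ => exists_congr fun e => and_congr_right fun _ =>
    and_congr_right fun h1 => and_congr_right fun h2 => ?_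
  rw [h _ h1.1 h1.2, h _ h2.1 h2.2]

/-- This is where the restriction `k < l` matters: for `i = j` it keeps the bad columns independent
of the edges not yet revealed. -/
lemma heavyColumns_congr {p m δ : ℕ} {Ω : Finset (Fin p × Fin p)} {i j : Fin p} {h r : ℝ}
    {G G' : LeftRegularGraph p m δ} {l : Fin δ} (hG : AgreeBefore j l G G') :
    heavyColumns Ω i j h r G l = heavyColumns Ω i j h r G' l := by
  classical
  have hfar : farCells Ω i j G = farCells Ω i j G' := farCells_congr fun i' _ hj => hG.1 i' hj
  unfold heavyColumns
  rw [hfar]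
  refine Finset.filter_congr fun v _ => ?_
  have hfilter : (Finset.univ.filter fun k : Fin δ => (i ≠ j ∨ k < l) ∧
      G i k ∉ heavyRows (farCells Ω i j G') h ∧ (G i k, v) ∈ farCells Ω i j G') =
      Finset.univ.filter fun k : Fin δ => (i ≠ j ∨ k < l) ∧
        G' i k ∉ heavyRows (farCells Ω i j G') h ∧ (G' i k, v) ∈ farCells Ω i j G' := by
    refine Finset.filter_congr fun k _ => and_congr_right fun hk => ?_
    have : G i k = G' i k := by
      by_cases hij : i = j
      · subst hij
        exact hG.2 k (hk.resolve_left fun h => h rfl)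
      · rw [hG.1 i hij]
    rw [this]
  rw [hfilter]

open Classical in
/-- Half of the possible collisions at the pair `(i, j)`: those in the second coordinate, and those
with far cells for edges at `j` drawn after the edges at `i`. -/
noncomputable def halfCollisions {p m δ : ℕ} (Ω : Finset (Fin p × Fin p)) (i j : Fin p)
    (G : LeftRegularGraph p m δ) : Finset (Fin δ × Fin δ) :=
  Finset.univ.filter fun κ => G j κ.2 ∈ rowReach Ω i j G ∨
    (i ≠ j ∨ κ.1 < κ.2) ∧ (G i κ.1, G j κ.2) ∈ farCells Ω i j G

open Classical in
-- Transposing `Ω` exchanges the two coordinates, so the second half covers collisions in the first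
-- coordinate and, for `i = j`, the order `l < k`. The summand `δ` pays for the diagonal `k = l`,
-- where a single endpoint serves both coordinates.
lemma card_collisions_le {p m δ : ℕ} (Ω : Finset (Fin p × Fin p)) (i j : Fin p)
    (G : LeftRegularGraph p m δ) :
    (collisions G Ω (i, j)).card ≤ (halfCollisions Ω i j G).card +
      (halfCollisions (Ω.image Prod.swap) j i G).card + δ := by
  have hsub : collisions G Ω (i, j) ⊆ halfCollisions Ω i j G ∪
      (halfCollisions (Ω.image Prod.swap) j i G).image Prod.swap ∪
      Finset.univ.image fun k : Fin δ => (k, k) := by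
    rintro ⟨k, l⟩ hκ
    obtain ⟨⟨i', j'⟩, he, hne, ⟨k', hk'⟩, l', hl'⟩ := (Finset.mem_filter.1 hκ).2
    simp only at hk' hl'
    have hleft : (k, l) ∈ halfCollisions Ω i j G ↔ G j l ∈ rowReach Ω i j G ∨
        (i ≠ j ∨ k < l) ∧ (G i k, G j l) ∈ farCells Ω i j G := by
      simp [halfCollisions]
    have hright : (k, l) ∈ (halfCollisions (Ω.image Prod.swap) j i G).image Prod.swap ↔
        G i k ∈ rowReach (Ω.image Prod.swap) j i G ∨
        (j ≠ i ∨ l < k) ∧ (G j l, G i k) ∈ farCells (Ω.image Prod.swap) j i G := by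
      simp [halfCollisions]
    rw [Finset.mem_union, Finset.mem_union, hleft, hright]
    by_cases h1 : (j' ≠ j ∧ (j' = i ∨ i' = i))
    · left; left; left
      refine Finset.mem_filter.2 ⟨Finset.mem_univ _, j', h1.1, h1.2.imp_right ?_, l', hl'⟩
      rintro rfl
      exact he
    by_cases h2 : (i' ≠ i ∧ (i' = j ∨ j' = j))
    · left; right; left
      refine Finset.mem_filter.2 ⟨Finset.mem_univ _, i', h2.1, h2.2.imp_right ?_, k', hk'⟩
      rintro rfl
      simpa using he
    -- If `j' = j`, the failure of `h2` forces `i' = i`, contrary to `hne`. So `j' ≠ j`; the failure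
    -- of `h1` excludes `i` from both coordinates, and then that of `h2` gives `i' ≠ j`.
    have hfar : (i' ≠ i ∧ i' ≠ j) ∧ (j' ≠ i ∧ j' ≠ j) := by
      by_cases ha : i' = i <;> by_cases hb : j' = j <;> by_cases hc : j' = i <;>
        by_cases hd : i' = j <;> simp_all
    have hU : (G i k, G j l) ∈ farCells Ω i j G :=
      Finset.mem_filter.2 ⟨Finset.mem_univ _, (i', j'), he, hfar.1, hfar.2, ⟨k', hk'⟩, l', hl'⟩
    have hU' : (G j l, G i k) ∈ farCells (Ω.image Prod.swap) j i G :=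
      Finset.mem_filter.2 ⟨Finset.mem_univ _, (j', i'), by simpa using he, hfar.2.symm,
        hfar.1.symm, ⟨l', hl'⟩, k', hk'⟩
    by_cases hij : i = j
    · rcases lt_trichotomy k l with h | rfl | h
      · exact Or.inl (Or.inl (Or.inr ⟨Or.inr h, hU⟩))
      · exact Or.inr (by simp)
      · exact Or.inl (Or.inr (Or.inr ⟨Or.inr h, hU'⟩))
    · exact Or.inl (Or.inl (Or.inr ⟨Or.inl hij, hU⟩))
  refine (Finset.card_le_card hsub).trans ((Finset.card_union_le _ _).trans ?_)
  refine Nat.add_le_add ((Finset.card_union_le _ _).trans ?_) ?_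
  · exact Nat.add_le_add_left Finset.card_image_le _
  · exact Finset.card_image_le.trans (by simp)

open Classical in
lemma card_halfCollisions_le {p m δ : ℕ} (Ω : Finset (Fin p × Fin p)) (i j : Fin p) (h r : ℝ)
    (hr : 0 ≤ r) (G : LeftRegularGraph p m δ) :
    ((halfCollisions Ω i j G).card : ℝ) ≤
      ((Finset.univ.filter fun k => G i k ∈ heavyRows (farCells Ω i j G) h).card : ℝ) * δ +
      ((Finset.univ.filter fun l =>
        G j l ∈ rowReach Ω i j G ∪ heavyColumns Ω i j h r G l).card : ℝ) * δ + r * δ := by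
  set R := Finset.univ.filter fun k => G i k ∈ heavyRows (farCells Ω i j G) h with hR
  set C := Finset.univ.filter fun l =>
    G j l ∈ rowReach Ω i j G ∪ heavyColumns Ω i j h r G l with hC
  -- The condition `l ∉ C` empties `D l` for the bad `l`, so the bound `r` holds for every `l`.
  set D : Fin δ → Finset (Fin δ) := fun l => Finset.univ.filter fun k => l ∉ C ∧
    (i ≠ j ∨ k < l) ∧ G i k ∉ heavyRows (farCells Ω i j G) h ∧
      (G i k, G j l) ∈ farCells Ω i j G with hD
  have hsub : halfCollisions Ω i j G ⊆ R ×ˢ Finset.univ ∪ Finset.univ ×ˢ C ∪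
      (Finset.univ : Finset (Fin δ)).biUnion fun l => (D l).image fun k => (k, l) := by
    rintro ⟨k, l⟩ hκ
    have hκ' := (Finset.mem_filter.1 hκ).2
    simp only at hκ'
    by_cases hl : l ∈ C
    · simp [hl]
    by_cases hk : k ∈ R
    · simp [hk]
    refine Finset.mem_union_right _ (Finset.mem_biUnion.2 ⟨l, Finset.mem_univ _,
      Finset.mem_image.2 ⟨k, ?_, rfl⟩⟩)
    have hl' := hl
    simp only [hC, Finset.mem_filter, Finset.mem_univ, true_and, Finset.mem_union, not_or] at hl'
    have h2 := hκ'.resolve_left hl'.1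
    refine Finset.mem_filter.2 ⟨Finset.mem_univ _, hl, h2.1, ?_, h2.2⟩
    simpa [hR] using hk
  have hDcard : ∀ l, ((D l).card : ℝ) ≤ r := by
    intro l
    by_cases hl : l ∈ C
    · simpa [hD, hl] using hr
    have hl' := hl
    simp only [hC, Finset.mem_filter, Finset.mem_univ, true_and, Finset.mem_union, not_or] at hl'
    have h2 := hl'.2
    simp only [heavyColumns, Finset.mem_filter, Finset.mem_univ, true_and, not_lt] at h2
    simpa [hD, hl] using h2
  have hcard := (Finset.card_le_card hsub).trans ((Finset.card_union_le _ _).trans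
    (Nat.add_le_add (Finset.card_union_le _ _) (Finset.card_biUnion_le.trans
      (Finset.sum_le_sum fun l _ => Finset.card_image_le))))
  have hcard' : ((halfCollisions Ω i j G).card : ℝ) ≤
      (R.card : ℝ) * δ + δ * (C.card : ℝ) + ∑ l, ((D l).card : ℝ) := by
    simp only [Finset.card_product, Finset.card_univ, Fintype.card_fin] at hcard
    exact_mod_cast hcard
  have hsum : ∑ l, ((D l).card : ℝ) ≤ r * δ := by
    refine (Finset.sum_le_sum fun l _ => hDcard l).trans ?_
    simp [mul_comm]
  linarith

open Classical in
-- Outside two tail events, heavy rows, bad columns and the remaining far cells each account for at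
-- most `α * δ ^ 2` collisions. With `h = q * m`, there are at most `h` heavy rows and at most `(2 +
-- α⁻¹) * h` bad columns, which `hqη` keeps below density `η`.
lemma card_many_halfCollisions_le {p m δ : ℕ} (Ω : Finset (Fin p × Fin p)) (i j : Fin p)
    {α η q s : ℝ} (hα : 0 < α) (hη : η = (2 * Real.exp 1) ^ (-α⁻¹)) (hq : 0 < q)
    (hqη : q * (2 + α⁻¹) ≤ η) (hs : 1 ≤ s) (hm : s * δ ≤ q * m)
    (hrow : ((Ω.filter fun e => e.1 = i).card : ℝ) ≤ s) (hΩ : (Ω.card : ℝ) ≤ s ^ 2) :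
    ((Finset.univ.filter fun G : LeftRegularGraph p m δ =>
        3 * α * (δ : ℝ) ^ 2 < ((halfCollisions Ω i j G).card : ℝ)).card : ℝ) ≤
      2 * (Real.exp (-δ) * Fintype.card (LeftRegularGraph p m δ)) := by
  set h := q * m with hh
  have hh0 : 0 ≤ h := by positivity
  rcases Nat.eq_zero_or_pos δ with rfl | hδ
  · have hempty : (Finset.univ.filter fun G : LeftRegularGraph p m 0 =>
        3 * α * ((0 : ℕ) : ℝ) ^ 2 < ((halfCollisions Ω i j G).card : ℝ)) = ∅ := by
      refine Finset.filter_eq_empty_iff.2 fun G _ => ?_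
      simp [Finset.eq_empty_of_isEmpty]
    rw [hempty]
    simp only [Finset.card_empty, Nat.cast_zero]
    positivity
  have hδ' : (0 : ℝ) < δ := by exact_mod_cast hδ
  have hh1 : 0 < h := lt_of_lt_of_le (by positivity) hm
  have hrows : ∀ G : LeftRegularGraph p m δ, ∀ _l : Fin δ,
      ((heavyRows (farCells Ω i j G) h).card : ℝ) ≤ η * m := by
    intro G _
    have h1 := mul_card_heavyRows_le (farCells Ω i j G) h
    have h2 : ((farCells Ω i j G).card : ℝ) ≤ Ω.card * (δ * δ) := by
      exact_mod_cast card_farCells_le Ω i j G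
    -- The scaling of `m` enters here: there are at most `(s * δ) ^ 2 ≤ h ^ 2` far cells, hence at
    -- most `h` rows with more than `h` of them.
    have h3 : (Ω.card : ℝ) * (δ * δ) ≤ h * h := by
      calc (Ω.card : ℝ) * (δ * δ) ≤ s ^ 2 * (δ * δ) := by gcongr
        _ = (s * δ) * (s * δ) := by ring
        _ ≤ h * h := by gcongr
    have h4 : ((heavyRows (farCells Ω i j G) h).card : ℝ) ≤ h :=
      le_of_mul_le_mul_left (h1.trans (h2.trans h3)) hh1
    have h5 : 0 < α⁻¹ := by positivity
    have h6 : q ≤ η := by nlinarith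
    exact h4.trans (mul_le_mul_of_nonneg_right h6 (Nat.cast_nonneg m))
  have hcols : ∀ (G : LeftRegularGraph p m δ) (l : Fin δ),
      ((rowReach Ω i j G ∪ heavyColumns Ω i j h (α * δ) G l).card : ℝ) ≤ η * m := by
    intro G l
    have h1 : ((rowReach Ω i j G).card : ℝ) ≤ 2 * h := by
      calc ((rowReach Ω i j G).card : ℝ) ≤ ((Ω.filter fun e => e.1 = i).card + 1) * δ := by
            exact_mod_cast card_rowReach_le Ω i j G
        _ ≤ (s + s) * δ := by gcongr
        _ ≤ 2 * h := by linarith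
    have h2 : ((heavyColumns Ω i j h (α * δ) G l).card : ℝ) ≤ α⁻¹ * h := by
      have := mul_card_heavyColumns_le Ω i j hh0 (α * δ) G l
      rw [inv_mul_eq_div, le_div_iff₀ hα]
      refine le_of_mul_le_mul_left ?_ hδ'
      linarith
    have h3 : ((rowReach Ω i j G ∪ heavyColumns Ω i j h (α * δ) G l).card : ℝ) ≤
        (rowReach Ω i j G).card + (heavyColumns Ω i j h (α * δ) G l).card := by
      exact_mod_cast Finset.card_union_le _ _
    have h4 := mul_le_mul_of_nonneg_right hqη (Nat.cast_nonneg (α := ℝ) m)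
    rw [hh] at h1 h2
    linarith
  have htail₁ := card_many_hits_le hα hη i (fun G _ => heavyRows (farCells Ω i j G) h)
    (fun G G' l hG => by rw [farCells_congr fun i' hi' _ => hG.1 i' hi']) hrows
  have htail₂ := card_many_hits_le hα hη j
    (fun G l => rowReach Ω i j G ∪ heavyColumns Ω i j h (α * δ) G l)
    (fun G G' l hG => by rw [rowReach_congr hG.1, heavyColumns_congr hG]) hcols
  rw [two_mul]
  refine le_trans ?_ (add_le_add htail₁ htail₂)
  rw [← Nat.cast_add, Nat.cast_le]
  refine (Finset.card_le_card fun G hG => ?_).trans (Finset.card_union_le _ _)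
  have hG' := (Finset.mem_filter.1 hG).2
  by_contra hnot
  simp only [Finset.mem_union, Finset.mem_filter, Finset.mem_univ, true_and, not_or,
    not_lt] at hnot
  have h1 := card_halfCollisions_le Ω i j h (α * δ) (by positivity) G
  have h2 := mul_le_mul_of_nonneg_right hnot.1 hδ'.le
  have h3 := mul_le_mul_of_nonneg_right hnot.2 hδ'.le
  simp only [Finset.mem_union] at h1
  nlinarith

open Classical in
-- With `α = ε / 8` the two halves use `6 * α = 3 * ε / 4`, and `hδ` bounds the diagonal by the
-- remaining `ε / 4`.
lemma card_many_collisions_le {p m δ : ℕ} (Ω : Finset (Fin p × Fin p))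
    {ε η q s : ℝ} (hε : 0 < ε) (hη : η = (2 * Real.exp 1) ^ (-(ε / 8)⁻¹)) (hq : 0 < q)
    (hqη : q * (2 + (ε / 8)⁻¹) ≤ η) (hs : 1 ≤ s) (hm : s * δ ≤ q * m)
    (hrow : ∀ i, ((Ω.filter fun e => e.1 = i).card : ℝ) ≤ s)
    (hcol : ∀ i, ((Ω.filter fun e => e.2 = i).card : ℝ) ≤ s)
    (hΩ : (Ω.card : ℝ) ≤ s ^ 2) (hδ : 4 ≤ ε * δ) (e : Fin p × Fin p) :
    ((Finset.univ.filter fun G : LeftRegularGraph p m δ =>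
        ε * (δ : ℝ) ^ 2 < ((collisions G Ω e).card : ℝ)).card : ℝ) ≤
      4 * (Real.exp (-δ) * Fintype.card (LeftRegularGraph p m δ)) := by
  obtain ⟨i, j⟩ := e
  have hα : 0 < ε / 8 := by positivity
  have h1 := card_many_halfCollisions_le (m := m) (δ := δ) Ω i j hα hη hq hqη hs hm (hrow i) hΩ
  have hswap : (((Ω.image Prod.swap).filter fun e => e.1 = j).card : ℝ) ≤ s := by
    refine le_trans ?_ (hcol j)
    rw [Finset.filter_image, Nat.cast_le]
    exact Finset.card_image_le
  have hΩ' : ((Ω.image Prod.swap).card : ℝ) ≤ s ^ 2 := by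
    rwa [Finset.card_image_of_injective _ Prod.swap_injective]
  have h2 := card_many_halfCollisions_le (m := m) (δ := δ) (Ω.image Prod.swap) j i hα hη hq hqη hs
    hm hswap hΩ'
  have h3 := add_le_add h1 h2
  rw [← add_mul, show (2 : ℝ) + 2 = 4 by norm_num] at h3
  refine le_trans ?_ h3
  rw [← Nat.cast_add, Nat.cast_le]
  refine (Finset.card_le_card fun G hG => ?_).trans (Finset.card_union_le _ _)
  have hG' := (Finset.mem_filter.1 hG).2
  by_contra hnot
  simp only [Finset.mem_union, Finset.mem_filter, Finset.mem_univ, true_and, not_or,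
    not_lt] at hnot
  have h4 : ((collisions G Ω (i, j)).card : ℝ) ≤ (halfCollisions Ω i j G).card +
      (halfCollisions (Ω.image Prod.swap) j i G).card + δ := by
    exact_mod_cast card_collisions_le Ω i j G
  have h5 := mul_le_mul_of_nonneg_right hδ (Nat.cast_nonneg (α := ℝ) δ)
  nlinarith [hnot.1, hnot.2]

/-! ### The random graph -/

instance isProbabilityMeasure_randomGraph (p m δ : ℕ) [NeZero m] :
    IsProbabilityMeasure (randomGraph p m δ) := by
  unfold randomGraph
  infer_instance

lemma randomGraph_real_singleton {p m δ : ℕ} (G : LeftRegularGraph p m δ) :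
    (randomGraph p m δ).real {G} = (Fintype.card (LeftRegularGraph p m δ) : ℝ)⁻¹ := by
  have h : ∀ a : Fin m, uniformOn (Set.univ : Set (Fin m)) {a} = (m : ENNReal)⁻¹ := by
    intro a
    rw [uniformOn_univ]
    simp
  simp [randomGraph, Measure.real, Measure.pi_singleton, h, ← pow_mul]

lemma randomGraph_real_eq {p m δ : ℕ} (P : LeftRegularGraph p m δ → Prop) [DecidablePred P] :
    (randomGraph p m δ).real {G | P G} =
      (Finset.univ.filter P).card / (Fintype.card (LeftRegularGraph p m δ) : ℝ) := by
  have hset : {G | P G} = ((Finset.univ.filter P : Finset (LeftRegularGraph p m δ)) : Set _) := by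
    simp
  rcases isEmpty_or_nonempty (LeftRegularGraph p m δ) with hE | hE
  · have : {G : LeftRegularGraph p m δ | P G} = ∅ := Set.eq_empty_of_isEmpty _
    rw [this]
    simp [Finset.eq_empty_of_isEmpty]
  have hfin : ∀ G : LeftRegularGraph p m δ, randomGraph p m δ {G} ≠ ⊤ := by
    intro G h
    have h1 := randomGraph_real_singleton G
    rw [Measure.real, h, ENNReal.toReal_top, eq_comm, inv_eq_zero, Nat.cast_eq_zero] at h1
    exact Fintype.card_ne_zero h1
  -- Finiteness comes from the singletons because `m = 0` is allowed.
  have : IsFiniteMeasure (randomGraph p m δ) := by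
    refine ⟨?_⟩
    rw [← Set.biUnion_of_singleton Set.univ]
    exact (measure_biUnion_lt_top Set.finite_univ fun G _ => (hfin G).lt_top)
  rw [hset, ← sum_measureReal_singleton]
  simp [randomGraph_real_singleton, div_eq_mul_inv]

/-- The witness is `√(min d p * p)`: without the minimum, `d` could exceed `√(d * p)`. The diagonal
condition ensures `1 ≤ s`. -/
lemma card_distributed_bounds {p d : ℕ} {S : Finset (Fin p × Fin p)} (hp : 0 < p)
    (hS : IsDistributed d S) :
    ∃ s : ℝ, 1 ≤ s ∧ s ≤ Real.sqrt (d * p) ∧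
      (∀ i, ((S.filter fun e => e.1 = i).card : ℝ) ≤ s) ∧
      (∀ i, ((S.filter fun e => e.2 = i).card : ℝ) ≤ s) ∧ (S.card : ℝ) ≤ s ^ 2 := by
  classical
  have hrow : ∀ i, (S.filter fun e => e.1 = i).card ≤ min d p := by
    refine fun i => le_min (hS.2 i).1 ?_
    have : Set.InjOn Prod.snd (S.filter fun e => e.1 = i : Set (Fin p × Fin p)) := by
      rintro a ha b hb hab
      simp only [Finset.coe_filter, Set.mem_ofPred_eq] at ha hb
      exact Prod.ext (ha.2.trans hb.2.symm) hab
    rw [← Finset.card_image_of_injOn this]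
    exact (Finset.card_le_univ _).trans (by simp)
  have hcol : ∀ i, (S.filter fun e => e.2 = i).card ≤ min d p := by
    refine fun i => le_min (hS.2 i).2 ?_
    have : Set.InjOn Prod.fst (S.filter fun e => e.2 = i : Set (Fin p × Fin p)) := by
      rintro a ha b hb hab
      simp only [Finset.coe_filter, Set.mem_ofPred_eq] at ha hb
      exact Prod.ext hab (ha.2.trans hb.2.symm)
    rw [← Finset.card_image_of_injOn this]
    exact (Finset.card_le_univ _).trans (by simp)
  have hpos : 1 ≤ min d p := by
    refine le_trans ?_ (hrow ⟨0, hp⟩)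
    exact Finset.card_pos.2 ⟨(⟨0, hp⟩, ⟨0, hp⟩), by simp [hS.1]⟩
  have hcard : S.card ≤ min d p * p := by
    rw [Finset.card_eq_sum_card_fiberwise (f := Prod.fst) (t := Finset.univ)
      fun _ _ => Finset.mem_coe.2 (Finset.mem_univ _)]
    refine (Finset.sum_le_sum fun i _ => hrow i).trans ?_
    simp [mul_comm]
  set D := min d p
  have hD : (D : ℝ) ≤ Real.sqrt (D * p) := by
    refine Real.le_sqrt_of_sq_le ?_
    rw [sq]
    have : D ≤ p := min_le_right _ _
    gcongr
  have hD1 : (1 : ℝ) ≤ D := by exact_mod_cast hpos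
  refine ⟨Real.sqrt (D * p), hD1.trans hD, ?_, fun i => le_trans ?_ hD, fun i => le_trans ?_ hD, ?_⟩
  · have : D ≤ d := min_le_left _ _
    gcongr
  · exact_mod_cast hrow i
  · exact_mod_cast hcol i
  · rw [Real.sq_sqrt (by positivity)]
    exact_mod_cast hcard

open Classical in
/-- With high probability only few of the edges leaving each pair of `Ω` collide. -/
lemma randomGraph_real_exists_many_collisions_le {p m δ : ℕ} (Ω : Finset (Fin p × Fin p))
    {ε η q s : ℝ} (hε : 0 < ε) (hη : η = (2 * Real.exp 1) ^ (-(ε / 8)⁻¹)) (hq : 0 < q)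
    (hqη : q * (2 + (ε / 8)⁻¹) ≤ η) (hs : 1 ≤ s) (hm : s * δ ≤ q * m)
    (hrow : ∀ i, ((Ω.filter fun e => e.1 = i).card : ℝ) ≤ s)
    (hcol : ∀ i, ((Ω.filter fun e => e.2 = i).card : ℝ) ≤ s)
    (hΩ : (Ω.card : ℝ) ≤ s ^ 2) (hδ : 4 ≤ ε * δ) :
    (randomGraph p m δ).real
        {G | ∃ e ∈ Ω, ε * (δ : ℝ) ^ 2 < ((collisions G Ω e).card : ℝ)} ≤
      4 * (p : ℝ) ^ 2 * Real.exp (-δ) := by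
  rw [randomGraph_real_eq]
  refine div_le_of_le_mul₀ (Nat.cast_nonneg _) (by positivity) ?_
  have hsub : (Finset.univ.filter fun G : LeftRegularGraph p m δ =>
      ∃ e ∈ Ω, ε * (δ : ℝ) ^ 2 < ((collisions G Ω e).card : ℝ)) ⊆
      (Finset.univ : Finset (Fin p × Fin p)).biUnion fun e => Finset.univ.filter fun G =>
        ε * (δ : ℝ) ^ 2 < ((collisions G Ω e).card : ℝ) := by
    intro G hG
    obtain ⟨e, -, he⟩ := (Finset.mem_filter.1 hG).2
    exact Finset.mem_biUnion.2 ⟨e, Finset.mem_univ _, Finset.mem_filter.2 ⟨Finset.mem_univ _, he⟩⟩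
  have hcard := (Finset.card_le_card hsub).trans Finset.card_biUnion_le
  refine (Nat.cast_le (α := ℝ).2 hcard).trans ?_
  rw [Nat.cast_sum]
  refine (Finset.sum_le_sum fun e _ => card_many_collisions_le Ω hε hη hq hqη hs hm hrow hcol hΩ
    hδ e).trans (le_of_eq ?_)
  rw [Finset.sum_const, Finset.card_univ, Fintype.card_prod, Fintype.card_fin, nsmul_eq_mul]
  push_cast
  ring

lemma l1norm_sketch_of_le_one {p m δ : ℕ} (hp : p ≤ 1) (G : LeftRegularGraph p m δ)
    (X : Matrix (Fin p) (Fin p) ℝ) :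
    (δ : ℝ) ^ 2 * l1norm X ≤ l1norm (adjMatrix G * X * (adjMatrix G)ᵀ) := by
  classical
  have hsub : Subsingleton (Fin p) := Fin.subsingleton_iff_le_one.2 hp
  have h := le_l1norm_sketch G (Ω := Finset.univ) (X := X) (fun _ _ _ => Finset.mem_univ _)
    (ε := 0) fun e _ => ?_
  · simpa using h
  · have : collisions G Finset.univ e = ∅ :=
      Finset.filter_eq_empty_iff.2 fun κ _ ⟨e', _, hne, _⟩ => hne (Subsingleton.elim _ _)
    simp [this]

lemma four_mul_sq_mul_exp_neg_lt {x δ C : ℝ} (hx : 2 ≤ x) (hC : 6 ≤ C)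
    (hδ : C * Real.log x ≤ δ) : 4 * x ^ 2 * Real.exp (-δ) < x ^ (-1 : ℝ) := by
  have hx0 : 0 < x := by linarith
  have hlog : 0 ≤ Real.log x := Real.log_nonneg (by linarith)
  have h1 : Real.exp (-δ) ≤ (x ^ 6)⁻¹ := by
    rw [← Real.rpow_natCast, ← Real.rpow_neg hx0.le, Real.rpow_def_of_pos hx0]
    refine Real.exp_le_exp.2 ?_
    push_cast
    nlinarith
  calc 4 * x ^ 2 * Real.exp (-δ) ≤ 4 * x ^ 2 * (x ^ 6)⁻¹ := by gcongr
    _ < x ^ (-1 : ℝ) := by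
      rw [Real.rpow_neg_one, ← div_eq_mul_inv, div_lt_iff₀ (by positivity), inv_mul_eq_div,
        lt_div_iff₀ hx0]
      have h3 : 4 < x ^ 3 := by
        have : (2 : ℝ) ^ 3 ≤ x ^ 3 := by gcongr
        linarith
      have : 0 < x ^ 3 := by positivity
      calc 4 * x ^ 2 * x = 4 * x ^ 3 := by ring
        _ < x ^ 3 * x ^ 3 := by gcongr
        _ = x ^ 6 := by ring

end L1RIP

theorem mainTheorem5 :
    -- the upper bound, for every graph and every matrix
    (∀ (p m δ : ℕ) (G : L1RIP.LeftRegularGraph p m δ) (X : Matrix (Fin p) (Fin p) ℝ),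
      L1RIP.l1norm (L1RIP.adjMatrix G * X * (L1RIP.adjMatrix G)ᵀ) ≤
        (δ : ℝ) ^ 2 * L1RIP.l1norm X) ∧
    -- both bounds, with high probability
    (∀ ε : ℝ, 0 < ε → ε < 1 / 4 →
      ∃ c C₁ C₂ : ℝ, 0 < c ∧ 0 < C₁ ∧ 0 < C₂ ∧
        ∀ (p d δ m : ℕ), 0 < p →
          C₁ * Real.log (p : ℝ) ≤ (δ : ℝ) →
          C₂ * (δ : ℝ) * Real.sqrt ((d : ℝ) * (p : ℝ)) ≤ (m : ℝ) →
          ∀ X : Matrix (Fin p) (Fin p) ℝ, L1RIP.IsDistributedSparse d X →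
            1 - (p : ℝ) ^ (-c) <
              (L1RIP.randomGraph p m δ).real
                {G | (1 - 2 * ε) * (δ : ℝ) ^ 2 * L1RIP.l1norm X ≤
                      L1RIP.l1norm (L1RIP.adjMatrix G * X * (L1RIP.adjMatrix G)ᵀ) ∧
                    L1RIP.l1norm (L1RIP.adjMatrix G * X * (L1RIP.adjMatrix G)ᵀ) ≤
                      (δ : ℝ) ^ 2 * L1RIP.l1norm X}) := by
  refine ⟨fun p m δ G X => L1RIP.l1norm_sketch_le G X, fun ε hε _ => ?_⟩
  set η : ℝ := (2 * Real.exp 1) ^ (-(ε / 8)⁻¹) with hη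
  have hη0 : 0 < η := by positivity
  set q := η / (2 + (ε / 8)⁻¹) with hq
  have hq0 : 0 < q := by positivity
  have hqη : q * (2 + (ε / 8)⁻¹) ≤ η := (div_mul_cancel₀ _ (by positivity)).le
  -- The `6` makes `exp (-δ) ≤ p ^ (-6)`, enough for the union bound; the `8 / ε` gives `4 ≤ ε * δ`,
  -- as `log p ≥ 1 / 2` for `p ≥ 2`.
  refine ⟨1, 6 + 8 / ε, q⁻¹, one_pos, by positivity, by positivity, ?_⟩
  intro p d δ m hp hδ hm X ⟨S, hS, hXS⟩
  obtain ⟨s, hs, hsd, hrow, hcol, hcard⟩ := L1RIP.card_distributed_bounds hp hS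
  have hsm : s * δ ≤ q * m := by
    rw [mul_assoc, inv_mul_le_iff₀ hq0] at hm
    refine le_trans ?_ hm
    rw [mul_comm]
    gcongr
  have hnorm : 0 ≤ (δ : ℝ) ^ 2 * L1RIP.l1norm X :=
    mul_nonneg (sq_nonneg _)
      (Finset.sum_nonneg fun _ _ => Finset.sum_nonneg fun _ _ => abs_nonneg _)
  rcases Nat.lt_or_ge 1 p with hp2 | hp1
  · have hp2' : (2 : ℝ) ≤ p := by exact_mod_cast hp2
    have hlog : 1 / 2 ≤ Real.log p := by
      have h1 := Real.log_two_gt_d9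
      have h2 := Real.log_le_log two_pos hp2'
      linarith
    have hδ4 : 4 ≤ ε * δ := by
      have h1 : (8 / ε) * (1 / 2) ≤ δ := by
        refine le_trans ?_ hδ
        gcongr
        linarith
      calc (4 : ℝ) = ε * (8 / ε * (1 / 2)) := by field_simp; norm_num
        _ ≤ ε * δ := by gcongr
    have hδ0 : (0 : ℝ) < δ := pos_of_mul_pos_right (by linarith) hε.le
    have hm0 : m ≠ 0 := by
      rintro rfl
      have : 0 < s * δ := by positivity
      simp at hsm
      linarith
    have : NeZero m := ⟨hm0⟩
    have hbad := L1RIP.randomGraph_real_exists_many_collisions_le S hε hη hq0 hqη hs hsm hrow hcol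
      hcard hδ4
    have hC : 6 ≤ 6 + 8 / ε := by
      have : 0 < 8 / ε := by positivity
      linarith
    have hlt := hbad.trans_lt (L1RIP.four_mul_sq_mul_exp_neg_lt hp2' hC hδ)
    have hcompl := MeasureTheory.probReal_compl_eq_one_sub (μ := L1RIP.randomGraph p m δ)
      (Set.toFinite {G : L1RIP.LeftRegularGraph p m δ |
        ∃ e ∈ S, ε * (δ : ℝ) ^ 2 < ((L1RIP.collisions G S e).card : ℝ)}).measurableSet
    refine lt_of_lt_of_le (sub_lt_sub_left hlt 1) (hcompl.symm.le.trans ?_)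
    refine MeasureTheory.measureReal_mono fun G hG => ?_
    simp only [Set.mem_compl_iff, Set.mem_ofPred_eq, not_exists, not_and, not_lt] at hG
    -- The collision bound yields the factor `1 - ε`, which is stronger than required.
    refine ⟨le_trans ?_ (L1RIP.le_l1norm_sketch G hXS hG), L1RIP.l1norm_sketch_le G X⟩
    rw [mul_assoc, mul_assoc]
    gcongr
    linarith
  -- For `p = 1` there is only one pair, so nothing collides and the event is certain; `δ = m = 0`
  -- is possible here.
  · have hp1' : p = 1 := le_antisymm hp1 hp
    have huniv : {G : L1RIP.LeftRegularGraph p m δ | (1 - 2 * ε) * (δ : ℝ) ^ 2 * L1RIP.l1norm X ≤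
          L1RIP.l1norm (L1RIP.adjMatrix G * X * (L1RIP.adjMatrix G)ᵀ) ∧
        L1RIP.l1norm (L1RIP.adjMatrix G * X * (L1RIP.adjMatrix G)ᵀ) ≤
          (δ : ℝ) ^ 2 * L1RIP.l1norm X} = {G | True} := by
      ext G
      refine iff_of_true ⟨le_trans ?_ (L1RIP.l1norm_sketch_of_le_one hp1 G X),
        L1RIP.l1norm_sketch_le G X⟩ trivial
      rw [mul_assoc]
      exact mul_le_of_le_one_left hnorm (by linarith)
    have hne : Nonempty (L1RIP.LeftRegularGraph p m δ) := by
      rcases Nat.eq_zero_or_pos m with rfl | hm0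
      · have hδ0 : δ = 0 := by
          have h1 : s * δ ≤ 0 := by simpa using hsm
          have h2 : (δ : ℝ) ≤ 0 := by nlinarith [Nat.cast_nonneg (α := ℝ) δ]
          exact_mod_cast le_antisymm h2 (Nat.cast_nonneg δ)
        subst hδ0
        exact ⟨fun _ k => k.elim0⟩
      · exact ⟨fun _ _ => ⟨0, hm0⟩⟩
    rw [huniv, L1RIP.randomGraph_real_eq, Finset.filter_true, Finset.card_univ,
      div_self (Nat.cast_ne_zero.2 Fintype.card_ne_zero), hp1']
    simp
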